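/- **Games.** Let $0<X_A\le X_B$, $n\ge 3$, battlefield values $w^A_i,w^B_i>0$ ($1\le i\le n$), and let $\zeta=(\zeta_A,\zeta_B)$ be a pair of contest success functions, i.e. functions $\mathbb R_{\ge0}^2\to\mathbb R_{\ge 0}$ with $\zeta_A+\zeta_B=1$, $\zeta_A(x,y)$ non-decreasing in $x$ and non-increasing in $y$, and $\zeta_B(x,y)$ non-decreasing in $y$ and non-increasing in $x$. In the Generalized Lottery Blotto game $\mathcal{GLB}_n^{X_A,X_B}(\zeta)$ a pure strategy of player $P\in\{A,B\}$ is $x^P\in\mathbb R^n_{\ge0}$ with $\sum_i x^P_i\le X_P$; a mixed strategy is a probability distribution on $\mathbb R^n$ concentrated on pure strategies. The payoffs are $\Pi^\zeta_P(x^A,x^B)=\sum_i w^P_i\,\zeta_P(x^A_i,x^B_i)$, and for mixed strategies $\Pi^\zeta_P(s,t)$ is the expected payoff for independent draws from $s$ (Player A) and $t$ (Player B). The game is constant-sum if $w^A_i=w^B_i$ for all $i$. Assumption (A0) with bounds $0<\underline w\le\bar w$ says $\underline w\le w^P_i\le\bar w$ for all $i$ and $P$. Put $W_P=\sum_i w^P_i$,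 $W=\max\{W_A,W_B\}$, $v^P_i=w^P_i/W_P$. **The independently uniform strategy.** For $\gamma>0$ let $\Omega(\gamma)=\{i: v^A_i/v^B_i>\gamma\}$, and let $\mathcal S$ be the set of all $\gamma>0$ with $$\frac{X_B\gamma}{X_A}=\frac{\gamma^2\sum_{i\in\Omega(\gamma)}\frac{(v^B_i)^2}{v^A_i}+\sum_{i\notin\Omega(\gamma)}v^A_i}{\sum_{i\in\Omega(\gamma)}v^B_i+\frac1{\gamma^2}\sum_{i\notin\Omega(\gamma)}\frac{(v^A_i)^2}{v^B_i}} .$$ For $\gamma\in\mathcal S$ put $$\lambda_A=\frac{\gamma^2}{2X_B}\sum_{i\in\Omega(\gamma)}\frac{(v^B_i)^2}{v^A_i}+\frac1{2X_B}\sum_{i\notin\Omega(\gamma)}v^A_i,\qquad \lambda_B=\frac1{2X_A}\sum_{i\in\Omega(\gamma)}v^B_i+\frac1{2\gamma^2X_A}\sum_{i\notin\Omega(\gamma)}\frac{(v^A_i)^2}{v^B_i},$$ and let $a_i=v^A_i/\lambda_A$, $b_i=v^B_i/\lambda_B$. For $0<b\le d$ let $U(b,d)$ be the distribution with CDF $\frac{d-b}{d}+\frac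 xd$ on $[0,b]$. Let $F_{A^*_i}=U(b_i,b_i)$ and $F_{B^*_i}=U(b_i,a_i)$ if $i\in\Omega(\gamma)$, and $F_{A^*_i}=U(a_i,b_i)$ and $F_{B^*_i}=U(a_i,a_i)$ if $i\notin\Omega(\gamma)$. The strategy $\mathrm{IU}^\gamma_A$ draws $z_i\sim F_{A^*_i}$ independently and plays $x_i=X_A z_i/\sum_j z_j$ (and $x=0$ if $\sum_j z_j=0$); $\mathrm{IU}^\gamma_B$ is defined likewise from the $F_{B^*_i}$ and $X_B$. **The sets $\Delta_\gamma(\zeta,\varepsilon)$.** Fix a tie-breaking parameter $\alpha\in[0,1]$. Let $\beta_A(x,y)$ be $1$, $\alpha$, $0$ according as $x>y$, $x=y$, $x<y$, and $\beta_B=1-\beta_A$. For $\varepsilon>0$ let $\Delta_\gamma(\zeta,\varepsilon)$ be the set of all $\delta\in[0,1]$ such that for every $i$ and all $x^*,y^*\in[0,2X_B]$ the set $\{x\in[0,2X_B]:|\zeta_A(x,y^*)-\beta_A(x,y^*)|\ge\varepsilon\}$ has probability at most $\delta$ under $F_{A^*_i}$, and $\{y\in[0,2X_B]:|\zeta_B(x^*,y)-\beta_B(x^*,y)|\ge\varepsilon\}$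 has probability at most $\delta$ under $F_{B^*_i}$. **Statement.** Let $0<X_A\le X_B$ and $0<\underline w\le\bar w$. There is a sequence $\varepsilon_n>0$, depending only on $X_A,X_B,\underline w,\bar w$, with $\varepsilon_n=\tilde{\mathcal O}(n^{-1/2})$ (that is, $\varepsilon_n=\mathcal O(n^{-1/2}(\ln n)^k)$ for some $k$), such that for every $n\ge3$, every pair $\zeta$ of contest success functions, every $\alpha\in[0,1]$, and every constant-sum game $\mathcal{GLB}_n^{X_A,X_B}(\zeta)$ satisfying (A0) with bounds $\underline w,\bar w$: $\mathcal S=\{X_B/X_A\}$, and for $\gamma\in\mathcal S$, $\mathrm{IU}^\gamma_A$ and $\mathrm{IU}^\gamma_B$ are mixed strategies of players A and B, and for every $\delta\in\Delta_\gamma(\zeta,\varepsilon_n)$ and all mixed strategies $\tilde s$ of A and $\tilde t$ of B, $$\inf_t\Pi^\zeta_A(\tilde s,t)\le\inf_t\Pi^\zeta_A(\mathrm{IU}^\gamma_A,t)+(8\delta+13\varepsilon_n)W,$$ $$\inf_s\Pi^\zeta_B(s,\tilde t)\le\inf_s\Pi^\zeta_B(s,\mathrm{IU}^\gamma_B)+(8\delta+13\varepsilon_n)W,$$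 the infima being over all mixed strategies of the opponent. -/

import Mathlib

open MeasureTheory Filter Asymptotics

noncomputable section

/-- `f = Õ(g)`: big-O with logarithmic factors ignored, i.e. `f n = O(g n * (log n) ^ k)` for
some fixed `k`. -/
def IsSoftO (f g : ℕ → ℝ) : Prop :=
  ∃ k : ℕ, f =O[atTop] fun n : ℕ => g n * Real.log (n : ℝ) ^ k

/-- A pair of contest success functions. They are functions on the closed quadrant `x, y ≥ 0`;
the values at negative arguments are irrelevant and unconstrained. -/
structure IsCSF (ζA ζB : ℝ → ℝ → ℝ) : Prop where
  nonneg_left : ∀ x y, 0 ≤ x → 0 ≤ y → 0 ≤ ζA x y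
  nonneg_right : ∀ x y, 0 ≤ x → 0 ≤ y → 0 ≤ ζB x y
  add_eq_one : ∀ x y, 0 ≤ x → 0 ≤ y → ζA x y + ζB x y = 1
  left_mono : ∀ x x' y, 0 ≤ x → x ≤ x' → 0 ≤ y → ζA x y ≤ ζA x' y
  left_anti : ∀ x y y', 0 ≤ x → 0 ≤ y → y ≤ y' → ζA x y' ≤ ζA x y
  right_mono : ∀ x y y', 0 ≤ x → 0 ≤ y → y ≤ y' → ζB x y ≤ ζB x y'
  right_anti : ∀ x x' y, 0 ≤ x → x ≤ x' → 0 ≤ y → ζB x' y ≤ ζB x y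

/-- The Blotto function of Player A with tie-breaking parameter `α`. -/
def blottoA (α x y : ℝ) : ℝ := if y < x then 1 else if x = y then α else 0

/-- The Blotto function of Player B with tie-breaking parameter `α`. -/
def blottoB (α x y : ℝ) : ℝ := if x < y then 1 else if y = x then 1 - α else 0

/-- Pure strategies on `n` battlefields with budget `X`. -/
def pureStrategies (n : ℕ) (X : ℝ) : Set (Fin n → ℝ) :=
  {x | (∀ i, 0 ≤ x i) ∧ ∑ i, x i ≤ X}

/-- Mixed strategies: joint probability distributions of the `n` allocations under which the
drawn allocation is almost surely a pure strategy. -/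
def mixedStrategies (n : ℕ) (X : ℝ) : Set (Measure (Fin n → ℝ)) :=
  {s | IsProbabilityMeasure s ∧ ∀ᵐ x ∂s, x ∈ pureStrategies n X}

/-- Expected value of `u` when the two players independently draw `x` from `s` and `y` from `t`.
The integral is iterated: contest success functions need not be jointly Borel measurable (their
values on the diagonal may be arbitrary), but the sections and the inner integrals are monotone
in each coordinate, hence measurable. -/
def expectedPayoff {n : ℕ} (u : (Fin n → ℝ) → (Fin n → ℝ) → ℝ)
    (s t : Measure (Fin n → ℝ)) : ℝ :=
  ∫ x, ∫ y, u x y ∂t ∂s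

/-- The distribution with CDF `(d - b) / d + x / d` on `[0, b]`, where `0 < b ≤ d`: an atom of mass
`(d - b) / d` at `0`, and the remaining mass spread uniformly over `[0, b]`. For `b = d` this is
the uniform distribution on `[0, d]`. -/
def uniformType (b d : ℝ) : Measure ℝ :=
  ENNReal.ofReal ((d - b) / d) • Measure.dirac 0 +
    ENNReal.ofReal (1 / d) • volume.restrict (Set.Icc 0 b)

/-- The re-scaling step of the independently uniform strategy: the drawn numbers are scaled so
that they sum to `X`; if their sum is `0`, nothing is allocated. -/
def rescale {n : ℕ} (X : ℝ) (a : Fin n → ℝ) : Fin n → ℝ :=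
  fun i => if ∑ j, a j = 0 then 0 else a i / (∑ j, a j) * X

/-- A Generalized Lottery Blotto game with `n` battlefields, budgets `XA`, `XB`, battlefield
values `wA i`, `wB i` and contest success functions `ζA`, `ζB`; `α` is the tie-breaking parameter
of the corresponding Colonel Blotto game. -/
structure GLBGame (n : ℕ) (XA XB : ℝ) where
  wA : Fin n → ℝ
  wB : Fin n → ℝ
  α : ℝ
  ζA : ℝ → ℝ → ℝ
  ζB : ℝ → ℝ → ℝ
  wA_pos : ∀ i, 0 < wA i
  wB_pos : ∀ i, 0 < wB i
  α_mem : α ∈ Set.Icc (0 : ℝ) 1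
  csf : IsCSF ζA ζB

namespace GLBGame

variable {n : ℕ} {XA XB : ℝ} (G : GLBGame n XA XB)

/-- The constant-sum variant: both players assign the same value to each battlefield. -/
def IsConstantSum : Prop := ∀ i, G.wA i = G.wB i

/-- The battlefield values of both players lie in `[wlo, whi]`. -/
def ValuesBounded (wlo whi : ℝ) : Prop :=
  ∀ i, (wlo ≤ G.wA i ∧ G.wA i ≤ whi) ∧ (wlo ≤ G.wB i ∧ G.wB i ≤ whi)

/-- Total value of the battlefields for Player A. -/
def WA : ℝ := ∑ i, G.wA i

/-- Total value of the battlefields for Player B. -/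
def WB : ℝ := ∑ i, G.wB i

/-- The larger of the two total values. -/
def W : ℝ := max G.WA G.WB

/-- Normalized values of Player A. -/
def vA (i : Fin n) : ℝ := G.wA i / G.WA

/-- Normalized values of Player B. -/
def vB (i : Fin n) : ℝ := G.wB i / G.WB

/-- Payoff of Player A for a pure strategy profile. -/
def purePayoffA (x y : Fin n → ℝ) : ℝ := ∑ i, G.wA i * G.ζA (x i) (y i)

/-- Payoff of Player B for a pure strategy profile. -/
def purePayoffB (x y : Fin n → ℝ) : ℝ := ∑ i, G.wB i * G.ζB (x i) (y i)

/-- Payoff of Player A when A plays the mixed strategy `s` and B plays `t`. -/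
def payoffA (s t : Measure (Fin n → ℝ)) : ℝ := expectedPayoff G.purePayoffA s t

/-- Payoff of Player B when A plays the mixed strategy `s` and B plays `t`. -/
def payoffB (s t : Measure (Fin n → ℝ)) : ℝ := expectedPayoff G.purePayoffB s t

/-- The worst-case payoff of Player A playing `s`: the infimum over the strategies of B. -/
def worstPayoffA (s : Measure (Fin n → ℝ)) : ℝ :=
  sInf ((fun t => G.payoffA s t) '' mixedStrategies n XB)

/-- The worst-case payoff of Player B playing `t`: the infimum over the strategies of A. -/
def worstPayoffB (t : Measure (Fin n → ℝ)) : ℝ :=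
  sInf ((fun s => G.payoffB s t) '' mixedStrategies n XA)

/-- The battlefields `i` with `vA i / vB i > γ`. -/
def Omega (γ : ℝ) : Finset (Fin n) := Finset.univ.filter fun i => γ < G.vA i / G.vB i

/-- The positive solutions `γ` of the equation that determines the uniform-type distributions. -/
def gammaSolutions : Set ℝ :=
  {γ | 0 < γ ∧
    XB * γ / XA =
      (γ ^ 2 * ∑ i ∈ G.Omega γ, G.vB i ^ 2 / G.vA i + ∑ i ∈ (G.Omega γ)ᶜ, G.vA i) /
        (∑ i ∈ G.Omega γ, G.vB i + 1 / γ ^ 2 * ∑ i ∈ (G.Omega γ)ᶜ, G.vA i ^ 2 / G.vB i)}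

/-- The constant `λ_A` associated with `γ`. -/
def lamA (γ : ℝ) : ℝ :=
  γ ^ 2 / (2 * XB) * ∑ i ∈ G.Omega γ, G.vB i ^ 2 / G.vA i +
    1 / (2 * XB) * ∑ i ∈ (G.Omega γ)ᶜ, G.vA i

/-- The constant `λ_B` associated with `γ`. -/
def lamB (γ : ℝ) : ℝ :=
  1 / (2 * XA) * ∑ i ∈ G.Omega γ, G.vB i +
    1 / (2 * γ ^ 2 * XA) * ∑ i ∈ (G.Omega γ)ᶜ, G.vA i ^ 2 / G.vB i

/-- The uniform-type distribution of Player A on battlefield `i`: strong (uniform) if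
`i ∈ Omega γ`, and weak (with an atom at `0`) otherwise. -/
def starA (γ : ℝ) (i : Fin n) : Measure ℝ :=
  if i ∈ G.Omega γ then uniformType (G.vB i / G.lamB γ) (G.vB i / G.lamB γ)
  else uniformType (G.vA i / G.lamA γ) (G.vB i / G.lamB γ)

/-- The uniform-type distribution of Player B on battlefield `i`: weak (with an atom at `0`) if
`i ∈ Omega γ`, and strong (uniform) otherwise. -/
def starB (γ : ℝ) (i : Fin n) : Measure ℝ :=
  if i ∈ G.Omega γ then uniformType (G.vB i / G.lamB γ) (G.vA i / G.lamA γ)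
  else uniformType (G.vA i / G.lamA γ) (G.vA i / G.lamA γ)

/-- The independently uniform strategy of Player A: draw independently from the uniform-type
distributions and re-scale to the budget. -/
def IUA (γ : ℝ) : Measure (Fin n → ℝ) := (Measure.pi (G.starA γ)).map (rescale XA)

/-- The independently uniform strategy of Player B. -/
def IUB (γ : ℝ) : Measure (Fin n → ℝ) := (Measure.pi (G.starB γ)).map (rescale XB)

/-- The allocations `x` of A at which `ζA x y` is `ε`-away from the Blotto function. -/
def farX (y ε : ℝ) : Set ℝ :=
  {x | x ∈ Set.Icc 0 (2 * XB) ∧ ε ≤ |G.ζA x y - blottoA G.α x y|}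

/-- The allocations `y` of B at which `ζB x y` is `ε`-away from the Blotto function. -/
def farY (x ε : ℝ) : Set ℝ :=
  {y | y ∈ Set.Icc 0 (2 * XB) ∧ ε ≤ |G.ζB x y - blottoB G.α x y|}

/-- The set of all `δ ∈ [0, 1]` that bound, uniformly in the battlefield and in the opponent's
allocation, the probability that a draw from a uniform-type distribution falls where the contest
success functions are `ε`-away from the Blotto functions. -/
def Delta (γ ε : ℝ) : Set ℝ :=
  {δ | δ ∈ Set.Icc (0 : ℝ) 1 ∧
    (∀ i, ∀ y ∈ Set.Icc 0 (2 * XB), (G.starA γ i).real (G.farX y ε) ≤ δ) ∧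
    (∀ i, ∀ x ∈ Set.Icc 0 (2 * XB), (G.starB γ i).real (G.farY x ε) ≤ δ)}

end GLBGame

end

/-! In a constant-sum game $v^A=v^B=v$, so every ratio is $1$ and the equation for $\gamma$ becomes
$\gamma X_B/X_A=\gamma^2$. Hence $\gamma=X_B/X_A\ge1$ and `Omega γ` is empty. With $V=2X_B$, player
P draws $z_i$ from `uniformType (V * v i) (V * v i / ρ)`, where $\rho=X_A/X_B$ for A and $\rho=1$
for B. The expected total of the draws is $\rho V/2$, exactly the player's budget.

Each player's strategy guarantees nearly its share of $W$: $\rho_A/2$ for A and $1-\rho_A/2$ for B,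
where $\rho_A=X_A/X_B$. By Hoeffding the draws rarely total more than $(1+\eta)$ times the budget.
Otherwise rescaling leaves at least $z_i/(1+\eta)$ on battlefield $i$, and monotonicity of the
contest function turns this into a lower bound. Against an allocation $y$, the chance that
$z_i/(1+\eta)>y_i$ is at least $\rho(1-(1+\eta)y_i/(Vv_i))$. This bound is affine in $y_i$ with
slope proportional to $1/v_i$, so the $v_i$-weighted sum sees $y$ only through its total, which is
at most the opponent's budget. Replacing the contest function by the Blotto function costs
$\varepsilon+(1+\eta)\delta$. All this is `le_integral_integral_map_rescale`.

Payoffs sum to $W$, so B's guarantee caps what any strategy of A can secure, and conversely. The two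
guarantees miss $W$ by at most $(7\varepsilon_n+2\delta)W$, which bounds the gap in both
inequalities. -/

noncomputable section

/-! ### Uniform-type distributions -/

section UniformType

variable {b d : ℝ}

instance isFiniteMeasure_uniformType (b d : ℝ) : IsFiniteMeasure (uniformType b d) := by
  have h1 : IsFiniteMeasure (ENNReal.ofReal ((d - b) / d) • Measure.dirac (0 : ℝ)) :=
    Measure.smul_finite _ ENNReal.ofReal_ne_top
  have h2 : IsFiniteMeasure (ENNReal.ofReal (1 / d) • volume.restrict (Set.Icc (0 : ℝ) b)) :=
    Measure.smul_finite _ ENNReal.ofReal_ne_top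
  unfold uniformType
  infer_instance

theorem isProbabilityMeasure_uniformType (hb : 0 < b) (hbd : b ≤ d) :
    IsProbabilityMeasure (uniformType b d) := by
  have hd : 0 < d := hb.trans_le hbd
  constructor
  simp only [uniformType, Measure.coe_add, Measure.coe_smul, Pi.add_apply, Pi.smul_apply,
    measure_univ, smul_eq_mul, mul_one, Measure.restrict_apply_univ, Real.volume_Icc, sub_zero]
  rw [← ENNReal.ofReal_mul (by positivity), ← ENNReal.ofReal_add
    (div_nonneg (by linarith) hd.le) (by positivity), ← ENNReal.ofReal_one]
  congr 1
  field_simp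
  ring

theorem ae_mem_Icc_uniformType (hb : 0 < b) : ∀ᵐ x ∂uniformType b d, x ∈ Set.Icc 0 b := by
  rw [uniformType, ae_add_measure_iff]
  constructor
  · refine Measure.ae_smul_measure ?_ _
    exact (ae_dirac_iff (p := (· ∈ Set.Icc 0 b)) measurableSet_Icc).2 ⟨le_rfl, hb.le⟩
  · exact Measure.ae_smul_measure (ae_restrict_mem measurableSet_Icc) _

theorem integral_uniformType (hb : 0 < b) (hbd : b ≤ d) {f : ℝ → ℝ}
    (hf : IntegrableOn f (Set.Icc 0 b)) :
    ∫ x, f x ∂uniformType b d = (d - b) / d * f 0 + 1 / d * ∫ x in (0 : ℝ)..b, f x := by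
  have hd : 0 < d := hb.trans_le hbd
  rw [uniformType, integral_add_measure, integral_smul_measure, integral_smul_measure,
    integral_dirac, intervalIntegral.integral_of_le hb.le, ← integral_Icc_eq_integral_Ioc,
    ENNReal.toReal_ofReal (div_nonneg (by linarith) hd.le), ENNReal.toReal_ofReal (by positivity)]
  · rfl
  · exact (integrable_dirac (by simp)).smul_measure ENNReal.ofReal_ne_top
  · exact hf.integrable.smul_measure ENNReal.ofReal_ne_top

theorem integral_id_uniformType (hb : 0 < b) (hbd : b ≤ d) :
    ∫ x, x ∂uniformType b d = b ^ 2 / (2 * d) := by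
  have hd : 0 < d := hb.trans_le hbd
  rw [integral_uniformType hb hbd (f := fun x => x) continuous_id.continuousOn.integrableOn_Icc, integral_id]
  field_simp
  ring

theorem uniformType_apply (b d : ℝ) {s : Set ℝ} (hs : MeasurableSet s) :
    uniformType b d s = ENNReal.ofReal ((d - b) / d) * s.indicator 1 0 +
      ENNReal.ofReal (1 / d) * volume (s ∩ Set.Icc 0 b) := by
  simp [uniformType, Measure.dirac_apply' _ hs, Measure.restrict_apply hs]

/-- Scaling down by `κ ≥ 1` pushes a uniform-type distribution to a measure of density at most `κ`
with respect to it. -/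
theorem uniformType_preimage_div_le {κ : ℝ} (hκ : 1 ≤ κ) {s : Set ℝ} (hs : MeasurableSet s) :
    uniformType b d ((fun x => x / κ) ⁻¹' s) ≤ ENNReal.ofReal κ * uniformType b d s := by
  have hκ0 : 0 < κ := by linarith
  have h1 : (1 : ENNReal) ≤ ENNReal.ofReal κ := by simpa using hκ
  rw [uniformType_apply b d ((measurable_id'.div_const κ) hs), uniformType_apply b d hs, mul_add]
  gcongr ?_ + ?_
  -- The atom sits at the fixed point of the scaling; only the Lebesgue part is stretched, by the
  -- factor $\kappa$.
  · have : ((fun x => x / κ) ⁻¹' s).indicator (1 : ℝ → ENNReal) 0 = s.indicator 1 0 := by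
      have h0 : (0 : ℝ) ∈ (fun x => x / κ) ⁻¹' s ↔ (0 : ℝ) ∈ s := by simp
      by_cases h : (0 : ℝ) ∈ s
      · rw [Set.indicator_of_mem h, Set.indicator_of_mem (h0.2 h)]
      · rw [Set.indicator_of_notMem h, Set.indicator_of_notMem fun h' => h (h0.1 h')]
    rw [this]
    exact le_mul_of_one_le_left (zero_le) h1
  · rw [mul_left_comm]
    gcongr
    calc volume ((fun x => x / κ) ⁻¹' s ∩ Set.Icc 0 b)
        ≤ volume ((fun x => κ⁻¹ * x) ⁻¹' (s ∩ Set.Icc 0 b)) := by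
          apply measure_mono
          rintro x ⟨hx, h0, hxb⟩
          refine ⟨by simpa [div_eq_inv_mul] using hx, by positivity, ?_⟩
          calc κ⁻¹ * x ≤ 1 * x := by gcongr; exact inv_le_one_of_one_le₀ hκ
            _ ≤ b := by linarith
      _ = ENNReal.ofReal κ * volume (s ∩ Set.Icc 0 b) := by
          rw [Real.volume_preimage_mul_left (by positivity), inv_inv, abs_of_pos hκ0]

/-- An equality for $c\le b$; beyond $b$ the left side is nonpositive. One affine bound in $c$ thus
serves all $c\ge0$ and can be averaged over the opponent's allocation. -/
theorem le_uniformType_real_Ioi (hb : 0 < b) (hbd : b ≤ d) {c : ℝ} (hc : 0 ≤ c) :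
    b / d * (1 - c / b) ≤ (uniformType b d).real (Set.Ioi c) := by
  have hd : 0 < d := hb.trans_le hbd
  rcases le_total b c with h | h
  · refine le_trans ?_ measureReal_nonneg
    have : 1 ≤ c / b := (one_le_div hb).2 h
    exact mul_nonpos_of_nonneg_of_nonpos (by positivity) (by linarith)
  · have : Set.Ioi c ∩ Set.Icc 0 b = Set.Ioc c b := by
      ext x
      simp only [Set.mem_inter_iff, Set.mem_Ioi, Set.mem_Icc, Set.mem_Ioc]
      exact ⟨fun h => ⟨h.1, h.2.2⟩, fun h => ⟨h.1, by linarith, h.2⟩⟩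
    have h0 : (0 : ℝ) ∉ Set.Ioi c := by simpa using hc
    rw [measureReal_def, uniformType_apply b d measurableSet_Ioi, this, Set.indicator_of_notMem h0,
      mul_zero, zero_add, Real.volume_Ioc, ← ENNReal.ofReal_mul (by positivity),
      ENNReal.toReal_ofReal (mul_nonneg (by positivity) (by linarith))]
    apply le_of_eq
    field_simp

end UniformType

/-! ### Exchanging integrals without joint measurability -/

section Swap

/-- The left Riemann sums of a bounded monotone function converge to its integral. -/
theorem tendsto_riemannSum_of_monotone {f : ℝ → ℝ} (hf : Monotone f) {b : ℝ} (hb : 0 < b) :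
    Tendsto (fun N : ℕ => b / (N + 1 : ℝ) * ∑ k ∈ Finset.range (N + 1), f (b / (N + 1 : ℝ) * k))
      atTop (nhds (∫ x in (0 : ℝ)..b, f x)) := by
  have hlim : Tendsto (fun N : ℕ => b * (f b - f 0) * (1 / ((N : ℝ) + 1))) atTop (nhds 0) := by
    simpa using tendsto_one_div_add_atTop_nhds_zero_nat.const_mul (b * (f b - f 0))
  have key : ∀ N : ℕ, |b / (N + 1 : ℝ) * ∑ k ∈ Finset.range (N + 1), f (b / (N + 1 : ℝ) * k) -
      ∫ x in (0 : ℝ)..b, f x| ≤ b * (f b - f 0) * (1 / ((N : ℝ) + 1)) := by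
    intro N
    set r : ℝ := b / (N + 1 : ℝ) with hr
    have hr0 : 0 < r := by positivity
    have hg : Monotone fun x => f (r * x) := fun x y hxy => hf (by gcongr)
    have hsc : r * (∫ x in (0 : ℝ)..0 + (N + 1 : ℕ), f (r * x)) = ∫ x in (0 : ℝ)..b, f x := by
      rw [intervalIntegral.integral_comp_mul_left _ hr0.ne', smul_eq_mul, mul_inv_cancel_left₀
        hr0.ne']
      congr 1 <;> push_cast [hr] <;> field_simp <;> ring
    have h1 := (hg.monotoneOn (Set.Icc 0 (0 + (N + 1 : ℕ)))).sum_le_integral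
    have h2 := (hg.monotoneOn (Set.Icc 0 (0 + (N + 1 : ℕ)))).integral_le_sum
    simp only [zero_add] at h1 h2 hsc
    -- The integral lies between the left and right Riemann sums, which differ only in their end
    -- terms.
    have h3 : ∑ i ∈ Finset.range (N + 1), f (r * ((i + 1 : ℕ) : ℝ)) =
        ∑ i ∈ Finset.range (N + 1), f (r * (i : ℝ)) + (f b - f 0) := by
      have := Finset.sum_range_succ' (fun i : ℕ => f (r * (i : ℝ))) (N + 1)
      rw [Finset.sum_range_succ] at this
      have hN : r * ((N + 1 : ℕ) : ℝ) = b := by push_cast [hr]; field_simp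
      rw [hN] at this
      simp only [Nat.cast_zero, mul_zero] at this
      linarith
    rw [h3] at h2
    have h4 : r * (f b - f 0) = b * (f b - f 0) * (1 / ((N : ℝ) + 1)) := by rw [hr]; ring
    have h1' := mul_le_mul_of_nonneg_left h1 hr0.le
    have h2' := mul_le_mul_of_nonneg_left h2 hr0.le
    rw [hsc] at h1' h2'
    rw [mul_add] at h2'
    rw [← h4, abs_le]
    constructor <;> linarith
  rw [tendsto_iff_norm_sub_tendsto_zero]
  exact squeeze_zero (fun _ => norm_nonneg _) key hlim

variable {α : Type*} [MeasurableSpace α] {t : Measure α} [IsProbabilityMeasure t]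
  {h : ℝ → α → ℝ}

theorem integrable_of_measurable_of_mem_Icc {β : Type*} [MeasurableSpace β] {μ : Measure β}
    [IsFiniteMeasure μ] {f : β → ℝ} (hf : Measurable f) (h0 : ∀ x, 0 ≤ f x) (h1 : ∀ x, f x ≤ 1) :
    Integrable f μ :=
  Integrable.of_mem_Icc 0 1 hf.aemeasurable (ae_of_all _ fun x => ⟨h0 x, h1 x⟩)

theorem monotone_integral (hmono : ∀ y, Monotone fun x => h x y)
    (hmeas : ∀ x, Measurable (h x)) (h0 : ∀ x y, 0 ≤ h x y) (h1 : ∀ x y, h x y ≤ 1) :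
    Monotone fun x => ∫ y, h x y ∂t := fun x x' hx =>
  integral_mono (integrable_of_measurable_of_mem_Icc (hmeas x) (h0 x) (h1 x))
    (integrable_of_measurable_of_mem_Icc (hmeas x') (h0 x') (h1 x')) fun y => hmono y hx

/-- The integral is a pointwise limit of Riemann sums, each a finite combination of measurable
sections. -/
theorem measurable_intervalIntegral_of_monotone (hmono : ∀ y, Monotone fun x => h x y)
    (hmeas : ∀ x, Measurable (h x)) {b : ℝ} (hb : 0 < b) :
    Measurable fun y => ∫ x in (0 : ℝ)..b, h x y := by
  refine measurable_of_tendsto_metrizable (f := fun (N : ℕ) y => b / (N + 1 : ℝ) *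
    ∑ k ∈ Finset.range (N + 1), h (b / (N + 1 : ℝ) * k) y) (fun N => ?_) ?_
  · exact (Finset.measurable_sum _ fun k _ => hmeas _).const_mul _
  · exact tendsto_pi_nhds.2 fun y => tendsto_riemannSum_of_monotone (hmono y) hb

/-- Fubini for a bounded function that is monotone in its first, real, variable; no joint
measurability is needed. -/
theorem intervalIntegral_integral_swap_of_monotone (hmono : ∀ y, Monotone fun x => h x y)
    (hmeas : ∀ x, Measurable (h x)) (h0 : ∀ x y, 0 ≤ h x y) (h1 : ∀ x y, h x y ≤ 1)
    {b : ℝ} (hb : 0 < b) :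
    ∫ x in (0 : ℝ)..b, ∫ y, h x y ∂t = ∫ y, (∫ x in (0 : ℝ)..b, h x y) ∂t := by
  have hint : ∀ x, Integrable (h x) t := fun x =>
    integrable_of_measurable_of_mem_Icc (hmeas x) (h0 x) (h1 x)
  have hA := tendsto_riemannSum_of_monotone (monotone_integral (t := t) hmono hmeas h0 h1) hb
  have hB : Tendsto (fun N : ℕ => ∫ y, b / (N + 1 : ℝ) *
      ∑ k ∈ Finset.range (N + 1), h (b / (N + 1 : ℝ) * k) y ∂t) atTop
      (nhds (∫ y, (∫ x in (0 : ℝ)..b, h x y) ∂t)) := by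
    refine tendsto_integral_of_dominated_convergence (fun _ => b) (fun N => ?_)
      (integrable_const _) (fun N => ae_of_all _ fun y => ?_)
      (ae_of_all _ fun y => tendsto_riemannSum_of_monotone (hmono y) hb)
    · exact ((Finset.measurable_sum _ fun k _ => hmeas _).const_mul _).aestronglyMeasurable
    · have hs0 : 0 ≤ ∑ k ∈ Finset.range (N + 1), h (b / (N + 1 : ℝ) * k) y :=
        Finset.sum_nonneg fun k _ => h0 _ _
      have hs1 : ∑ k ∈ Finset.range (N + 1), h (b / (N + 1 : ℝ) * k) y ≤ (N + 1 : ℝ) := by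
        calc _ ≤ ∑ k ∈ Finset.range (N + 1), (1 : ℝ) := Finset.sum_le_sum fun k _ => h1 _ _
          _ = _ := by simp
      rw [Real.norm_of_nonneg (by positivity)]
      calc _ ≤ b / (N + 1 : ℝ) * (N + 1 : ℝ) := by gcongr
        _ = b := by field_simp
  refine tendsto_nhds_unique hA (hB.congr fun N => ?_)
  rw [integral_const_mul, integral_finsetSum _ fun k _ => hint _]

theorem integral_uniformType_swap_of_monotone (hmono : ∀ y, Monotone fun x => h x y)
    (hmeas : ∀ x, Measurable (h x)) (h0 : ∀ x y, 0 ≤ h x y) (h1 : ∀ x y, h x y ≤ 1)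
    {b d : ℝ} (hb : 0 < b) (hbd : b ≤ d) :
    Measurable (fun y => ∫ x, h x y ∂uniformType b d) ∧
    ∫ x, ∫ y, h x y ∂t ∂uniformType b d = ∫ y, ∫ x, h x y ∂uniformType b d ∂t := by
  have hint : ∀ x, Integrable (h x) t := fun x =>
    integrable_of_measurable_of_mem_Icc (hmeas x) (h0 x) (h1 x)
  have hm := measurable_intervalIntegral_of_monotone hmono hmeas hb
  have hin : ∀ y, ∫ x, h x y ∂uniformType b d =
      (d - b) / d * h 0 y + 1 / d * ∫ x in (0 : ℝ)..b, h x y := fun y =>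
    integral_uniformType hb hbd (((hmono y).monotoneOn _).integrableOn_isCompact isCompact_Icc)
  have hbd' : ∀ y, 0 ≤ (∫ x in (0 : ℝ)..b, h x y) ∧ (∫ x in (0 : ℝ)..b, h x y) ≤ b := by
    intro y
    refine ⟨intervalIntegral.integral_nonneg hb.le fun x _ => h0 x y, ?_⟩
    calc ∫ x in (0 : ℝ)..b, h x y ≤ ∫ x in (0 : ℝ)..b, (1 : ℝ) :=
          intervalIntegral.integral_mono_on hb.le (hmono y).intervalIntegrable
            intervalIntegrable_const fun x _ => h1 x y
      _ = b := by simp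
  simp_rw [hin]
  refine ⟨((hmeas 0).const_mul _).add (hm.const_mul _), ?_⟩
  rw [integral_uniformType hb hbd (((monotone_integral hmono hmeas h0 h1).monotoneOn
    _).integrableOn_isCompact isCompact_Icc), integral_add ((hint 0).const_mul _)
    ((Integrable.of_mem_Icc 0 b hm.aemeasurable (ae_of_all _ hbd')).const_mul _),
    integral_const_mul, integral_const_mul,
    intervalIntegral_integral_swap_of_monotone hmono hmeas h0 h1 hb]

end Swap

/-- The expectation of a monotone function under a scaled-down uniform-type distribution, when
the function is close to the indicator of `(c, ∞)` with high probability. -/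
theorem le_integral_comp_div_uniformType {b d κ c V ε δ : ℝ} (hb : 0 < b) (hbd : b ≤ d)
    (hκ : 1 ≤ κ) (hc : 0 ≤ c) (hV : b ≤ V) (hε : 0 ≤ ε) {f : ℝ → ℝ} (hf : Monotone f)
    (h0 : ∀ x, 0 ≤ f x) (h1 : ∀ x, f x ≤ 1)
    (hbad : (uniformType b d).real {x | x ∈ Set.Icc 0 V ∧ c < x ∧ f x ≤ 1 - ε} ≤ δ) :
    b / d * (1 - κ * c / b) - ε - κ * δ ≤ ∫ z, f (z / κ) ∂uniformType b d := by
  have hκ0 : 0 < κ := by linarith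
  have := isProbabilityMeasure_uniformType hb hbd
  set μ := uniformType b d with hμ
  -- A measurable hull of the bad set, with the same measure.
  set T := toMeasurable μ {x | x ∈ Set.Icc 0 V ∧ c < x ∧ f x ≤ 1 - ε} with hT
  have hTm : MeasurableSet T := measurableSet_toMeasurable _ _
  have hdiv : Measurable fun z : ℝ => z / κ := measurable_id'.div_const κ
  have hTκ : MeasurableSet ((fun z => z / κ) ⁻¹' T) := hdiv hTm
  have hTδ : μ.real ((fun z => z / κ) ⁻¹' T) ≤ κ * δ := by
    calc μ.real ((fun z => z / κ) ⁻¹' T) ≤ (ENNReal.ofReal κ * μ T).toReal :=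
          ENNReal.toReal_mono (ENNReal.mul_ne_top ENNReal.ofReal_ne_top (measure_ne_top _ _))
            (uniformType_preimage_div_le hκ hTm)
      _ = κ * μ.real {x | x ∈ Set.Icc 0 V ∧ c < x ∧ f x ≤ 1 - ε} := by
          rw [ENNReal.toReal_mul, ENNReal.toReal_ofReal hκ0.le, hT, measure_toMeasurable,
            measureReal_def]
      _ ≤ κ * δ := by gcongr
  -- Where $z/\kappa$ is bad the left side is at most $0$; elsewhere $f(z/\kappa)>1-\varepsilon$ as
  -- soon as $z>\kappa c$.
  have hpt : ∀ᵐ z ∂μ, (Set.Ioi (κ * c)).indicator (1 : ℝ → ℝ) z - ε -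
      ((fun z => z / κ) ⁻¹' T).indicator (1 : ℝ → ℝ) z ≤ f (z / κ) := by
    filter_upwards [ae_mem_Icc_uniformType (d := d) hb] with z hz
    have hf0 := h0 (z / κ)
    by_cases hzT : z ∈ (fun z => z / κ) ⁻¹' T
    · rw [Set.indicator_of_mem hzT]
      have : (Set.Ioi (κ * c)).indicator (1 : ℝ → ℝ) z ≤ 1 :=
        Set.indicator_le_self' (by simp) z
      simp only [Pi.one_apply]
      linarith
    · rw [Set.indicator_of_notMem hzT]
      by_cases hzc : z ∈ Set.Ioi (κ * c)
      · rw [Set.indicator_of_mem hzc]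
        have hcz : c < z / κ := by rw [lt_div_iff₀ hκ0, mul_comm]; exact hzc
        have hzV : z / κ ≤ V := (div_le_self hz.1 hκ).trans (hz.2.trans hV)
        have hgt : 1 - ε < f (z / κ) := by
          by_contra hle
          exact hzT (subset_toMeasurable μ _ ⟨⟨div_nonneg hz.1 hκ0.le, hzV⟩, hcz, not_lt.1 hle⟩)
        simp only [Pi.one_apply]
        linarith
      · rw [Set.indicator_of_notMem hzc]
        linarith
  have hi1 : Integrable ((Set.Ioi (κ * c)).indicator (1 : ℝ → ℝ)) μ :=
    (integrable_const (1 : ℝ)).indicator measurableSet_Ioi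
  have hi2 : Integrable (((fun z => z / κ) ⁻¹' T).indicator (1 : ℝ → ℝ)) μ :=
    (integrable_const (1 : ℝ)).indicator hTκ
  have hif : Integrable (fun z => f (z / κ)) μ :=
    integrable_of_measurable_of_mem_Icc (hf.measurable.comp hdiv) (fun _ => h0 _) fun _ => h1 _
  have hi3 : Integrable (fun z => (Set.Ioi (κ * c)).indicator (1 : ℝ → ℝ) z - ε) μ :=
    hi1.sub (integrable_const ε)
  have hle := integral_mono_ae (hi3.sub hi2) hif hpt
  simp only [Pi.sub_apply] at hle
  rw [integral_sub hi3 hi2, integral_sub hi1 (integrable_const ε),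
    integral_indicator_one measurableSet_Ioi, integral_indicator_one hTκ, integral_const] at hle
  have := le_uniformType_real_Ioi hb hbd (mul_nonneg hκ0.le hc)
  simp only [probReal_univ, one_smul] at hle
  linarith

/-! ### Rescaling independent draws to the budget -/

section Rescale

variable {n : ℕ}

theorem measurable_rescale (X : ℝ) : Measurable (rescale (n := n) X) := by
  have hs : Measurable fun a : Fin n → ℝ => ∑ j, a j :=
    Finset.measurable_sum _ fun j _ => measurable_pi_apply j
  refine measurable_pi_lambda _ fun i => ?_
  exact Measurable.ite (measurableSet_eq_fun hs measurable_const) measurable_const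
    (((measurable_pi_apply i).div hs).mul_const X)

theorem rescale_mem_pureStrategies {X : ℝ} (hX : 0 ≤ X) {a : Fin n → ℝ} (ha : ∀ i, 0 ≤ a i) :
    rescale X a ∈ pureStrategies n X := by
  have hs : 0 ≤ ∑ j, a j := Finset.sum_nonneg fun j _ => ha j
  by_cases h : ∑ j, a j = 0
  · simp [pureStrategies, rescale, h, hX]
  · refine ⟨fun i => ?_, ?_⟩
    · simp only [rescale, h, if_false]
      exact mul_nonneg (div_nonneg (ha i) hs) hX
    · simp only [rescale, h, if_false]
      rw [← Finset.sum_mul, ← Finset.sum_div, div_self h, one_mul]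

theorem div_le_rescale {X κ : ℝ} (hκ : 0 < κ) {a : Fin n → ℝ}
    (ha : ∀ i, 0 ≤ a i) (hs : ∑ j, a j ≤ κ * X) (i : Fin n) : a i / κ ≤ rescale X a i := by
  have hs0 : 0 ≤ ∑ j, a j := Finset.sum_nonneg fun j _ => ha j
  by_cases h : ∑ j, a j = 0
  · have : a i = 0 := (Finset.sum_eq_zero_iff_of_nonneg fun j _ => ha j).1 h i (Finset.mem_univ i)
    simp [rescale, h, this]
  · have hpos : 0 < ∑ j, a j := lt_of_le_of_ne hs0 (Ne.symm h)
    simp only [rescale, h, if_false]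
    rw [div_mul_eq_mul_div, div_le_div_iff₀ hκ hpos, mul_assoc]
    exact mul_le_mul_of_nonneg_left (by linarith) (ha i)

variable (μ : Fin n → Measure ℝ) [∀ i, IsProbabilityMeasure (μ i)]

theorem ae_pi_of_forall_ae {p : ℝ → Prop} (hμ : ∀ i, ∀ᵐ x ∂μ i, p x) :
    ∀ᵐ z ∂Measure.pi μ, ∀ i, p (z i) :=
  ae_all_iff.2 fun i => (measurePreserving_eval μ i).quasiMeasurePreserving.ae (hμ i)

theorem measurableSet_pureStrategies (X : ℝ) : MeasurableSet (pureStrategies n X) := by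
  have hs : Measurable fun a : Fin n → ℝ => ∑ j, a j :=
    Finset.measurable_sum _ fun j _ => measurable_pi_apply j
  have h : pureStrategies n X = (⋂ i, {x | 0 ≤ x i}) ∩ {x | ∑ i, x i ≤ X} := by
    ext x
    simp [pureStrategies]
  rw [h]
  exact (MeasurableSet.iInter fun i => measurableSet_le measurable_const
    (measurable_pi_apply i)).inter (measurableSet_le hs measurable_const)

theorem map_rescale_mem_mixedStrategies (hμ : ∀ i, ∀ᵐ x ∂μ i, 0 ≤ x) {X : ℝ} (hX : 0 ≤ X) :
    (Measure.pi μ).map (rescale X) ∈ mixedStrategies n X := by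
  refine ⟨Measure.isProbabilityMeasure_map (measurable_rescale X).aemeasurable, ?_⟩
  refine (ae_map_iff (p := (· ∈ pureStrategies n X)) (measurable_rescale X).aemeasurable
    (measurableSet_pureStrategies X)).2 ?_
  filter_upwards [ae_pi_of_forall_ae μ hμ] with z hz using rescale_mem_pureStrategies hX hz

/-- Re-scaling independent draws to the budget `X` costs a monotone payoff little, unless the sum
of the draws exceeds the budget by a factor `κ`. -/
theorem le_integral_map_rescale (hμ : ∀ i, ∀ᵐ x ∂μ i, 0 ≤ x) {X κ : ℝ} (hκ : 0 < κ)
    {F : Fin n → ℝ → ℝ} (hF : ∀ i, Monotone (F i)) (h0 : ∀ i x, 0 ≤ F i x)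
    (h1 : ∀ i x, F i x ≤ 1) {w : Fin n → ℝ} (hw : ∀ i, 0 ≤ w i) :
    ∑ i, w i * ∫ z, F i (z / κ) ∂μ i - (∑ i, w i) * (Measure.pi μ).real {z | κ * X ≤ ∑ i, z i} ≤
      ∫ x, ∑ i, w i * F i (x i) ∂(Measure.pi μ).map (rescale X) := by
  have hsum : Measurable fun a : Fin n → ℝ => ∑ j, a j :=
    Finset.measurable_sum _ fun j _ => measurable_pi_apply j
  have hmeas : Measurable fun x : Fin n → ℝ => ∑ i, w i * F i (x i) :=
    Finset.measurable_sum _ fun i _ => ((hF i).measurable.comp (measurable_pi_apply i)).const_mul _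
  have hB : MeasurableSet {z : Fin n → ℝ | κ * X ≤ ∑ i, z i} :=
    measurableSet_le measurable_const hsum
  have hFκ : ∀ i, Measurable fun z => F i (z / κ) := fun i =>
    (hF i).measurable.comp (measurable_id'.div_const κ)
  have hI : ∀ i, Integrable (fun z : Fin n → ℝ => w i * F i (z i / κ)) (Measure.pi μ) := fun i =>
    (integrable_of_measurable_of_mem_Icc ((hFκ i).comp (measurable_pi_apply i))
      (fun _ => h0 i _) fun _ => h1 i _).const_mul _
  have hIB : Integrable ({z : Fin n → ℝ | κ * X ≤ ∑ i, z i}.indicator (1 : (Fin n → ℝ) → ℝ))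
      (Measure.pi μ) := (integrable_const (1 : ℝ)).indicator hB
  have hI' : Integrable (fun z => ∑ i, w i * F i (rescale X z i)) (Measure.pi μ) :=
    integrable_finsetSum _ fun i _ => (integrable_of_measurable_of_mem_Icc ((hF i).measurable.comp
      ((measurable_pi_apply i).comp (measurable_rescale X))) (fun _ => h0 i _)
        fun _ => h1 i _).const_mul _
  rw [integral_map (measurable_rescale X).aemeasurable hmeas.aestronglyMeasurable]
  have hleft : ∑ i, w i * ∫ z, F i (z / κ) ∂μ i -
      (∑ i, w i) * (Measure.pi μ).real {z | κ * X ≤ ∑ i, z i} =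
      ∫ z, (∑ i, w i * F i (z i / κ) - (∑ i, w i) *
        {z : Fin n → ℝ | κ * X ≤ ∑ i, z i}.indicator (1 : (Fin n → ℝ) → ℝ) z) ∂Measure.pi μ := by
    rw [integral_sub (integrable_finsetSum _ fun i _ => hI i) (hIB.const_mul _),
      integral_finsetSum _ fun i _ => hI i, integral_const_mul, integral_indicator_one hB]
    congr 1
    refine Finset.sum_congr rfl fun i _ => ?_
    rw [integral_const_mul]
    congr 1
    have hmp := measurePreserving_eval μ i
    rw [← hmp.map_eq, integral_map hmp.measurable.aemeasurable (hFκ i).aestronglyMeasurable]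
  rw [hleft]
  refine integral_mono_ae ((integrable_finsetSum _ fun i _ => hI i).sub (hIB.const_mul _)) hI' ?_
  filter_upwards [ae_pi_of_forall_ae μ hμ] with z hz
  -- When the draws overshoot, the whole value $\sum_i w_i$ is written off; otherwise
  -- `div_le_rescale` and monotonicity apply.
  by_cases hzB : z ∈ {z : Fin n → ℝ | κ * X ≤ ∑ i, z i}
  · rw [Set.indicator_of_mem hzB]
    have h2 : ∑ i, w i * F i (z i / κ) ≤ ∑ i, w i := Finset.sum_le_sum fun i _ =>
      mul_le_of_le_one_right (hw i) (h1 i _)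
    have h3 : 0 ≤ ∑ i, w i * F i (rescale X z i) := Finset.sum_nonneg fun i _ =>
      mul_nonneg (hw i) (h0 i _)
    simp only [Pi.one_apply, mul_one]
    linarith
  · rw [Set.indicator_of_notMem hzB, mul_zero, sub_zero]
    refine Finset.sum_le_sum fun i _ => mul_le_mul_of_nonneg_left (hF i ?_) (hw i)
    exact div_le_rescale hκ hz (le_of_lt (not_le.1 hzB)) i

end Rescale

/-! ### Concentration and the guaranteed payoff -/

/-- Hoeffding's inequality for independent draws from uniform-type distributions. -/
theorem pi_uniformType_real_le_sum {n : ℕ} {b d : Fin n → ℝ} (hb : ∀ i, 0 < b i)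
    (hbd : ∀ i, b i ≤ d i) {X η : ℝ} (hX : X = ∑ i, b i ^ 2 / (2 * d i)) (hX0 : 0 ≤ X)
    (hη : 0 ≤ η) :
    (Measure.pi fun i => uniformType (b i) (d i)).real {z | (1 + η) * X ≤ ∑ i, z i} ≤
      Real.exp (-(η * X) ^ 2 / (2 * ∑ i, (b i / 2) ^ 2)) := by
  have hp : ∀ i, IsProbabilityMeasure (uniformType (b i) (d i)) := fun i =>
    isProbabilityMeasure_uniformType (hb i) (hbd i)
  have hsub : ∀ i, ProbabilityTheory.HasSubgaussianMGF
      (fun x : ℝ => x - b i ^ 2 / (2 * d i)) ((‖b i - 0‖₊ / 2) ^ 2) (uniformType (b i) (d i)) := by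
    intro i
    have := ProbabilityTheory.hasSubgaussianMGF_of_mem_Icc (X := fun x : ℝ => x)
      (μ := uniformType (b i) (d i)) aemeasurable_id' (ae_mem_Icc_uniformType (hb i))
    rwa [integral_id_uniformType (hb i) (hbd i)] at this
  have hind := ProbabilityTheory.iIndepFun_pi (μ := fun i => uniformType (b i) (d i))
    (X := fun i x => x - b i ^ 2 / (2 * d i)) fun i => aemeasurable_id'.sub_const _
  have hsub' : ∀ i ∈ (Finset.univ : Finset (Fin n)), ProbabilityTheory.HasSubgaussianMGF
      (fun z : Fin n → ℝ => z i - b i ^ 2 / (2 * d i)) ((‖b i - 0‖₊ / 2) ^ 2)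
      (Measure.pi fun i => uniformType (b i) (d i)) := by
    intro i _
    have hmp := measurePreserving_eval (fun i => uniformType (b i) (d i)) i
    have := hsub i
    rw [← hmp.map_eq] at this
    exact this.of_map hmp.measurable.aemeasurable
  have hH := ProbabilityTheory.HasSubgaussianMGF.measure_sum_ge_le_of_iIndepFun hind hsub'
    (mul_nonneg hη hX0)
  refine le_trans (le_of_eq ?_) (hH.trans (le_of_eq ?_))
  · congr 1
    ext z
    simp only [Set.mem_ofPred_eq, Finset.sum_sub_distrib, ← hX]
    constructor <;> intro h <;> linarith
  · congr 3
    push_cast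
    refine Finset.sum_congr rfl fun i _ => ?_
    rw [sub_zero, Real.norm_of_nonneg (hb i).le]

/-- The payoff that the independently uniform strategy guarantees against any mixed strategy `t`,
when the contest function `Z` is close to the Blotto function with high probability. -/
theorem le_integral_integral_map_rescale {n : ℕ} {V ρ W ε δ η Y : ℝ} {v : Fin n → ℝ} (hV : 0 < V)
    (hρ : 0 < ρ) (hρ1 : ρ ≤ 1) (hW : 0 ≤ W) (hη : 0 ≤ η) (hε : 0 ≤ ε) (hv : ∀ i, 0 < v i)
    (hv1 : ∑ i, v i = 1) {Z : ℝ → ℝ → ℝ} (hmono : ∀ y, Monotone fun x => Z x y)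
    (hanti : ∀ x, Antitone (Z x)) (h0 : ∀ x y, 0 ≤ Z x y) (h1 : ∀ x y, Z x y ≤ 1)
    (hbad : ∀ i, ∀ y ∈ Set.Icc 0 V, (uniformType (V * v i) (V * v i / ρ)).real
      {x | x ∈ Set.Icc 0 V ∧ y < x ∧ Z x y ≤ 1 - ε} ≤ δ)
    {t : Measure (Fin n → ℝ)} (ht : t ∈ mixedStrategies n Y) (hY : Y ≤ V) :
    W * (ρ * (1 - (1 + η) * Y / V) - ε - (1 + η) * δ -
        Real.exp (-(η * (ρ * V / 2)) ^ 2 / (2 * ∑ i, (V * v i / 2) ^ 2))) ≤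
      ∫ x, ∫ y, ∑ i, W * v i * Z (x i) (y i) ∂t ∂(Measure.pi fun i =>
        uniformType (V * v i) (V * v i / ρ)).map (rescale (ρ * V / 2)) := by
  obtain ⟨htp, htm⟩ := ht
  have hb : ∀ i, 0 < V * v i := fun i => mul_pos hV (hv i)
  have hbd : ∀ i, V * v i ≤ V * v i / ρ := fun i => by
    rw [le_div_iff₀ hρ]
    exact mul_le_of_le_one_right (hb i).le hρ1
  have hp : ∀ i, IsProbabilityMeasure (uniformType (V * v i) (V * v i / ρ)) := fun i =>
    isProbabilityMeasure_uniformType (hb i) (hbd i)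
  have hκ : 0 < 1 + η := by linarith
  have hκ1 : 1 ≤ 1 + η := by linarith
  -- The mean total of the draws is the budget, so Hoeffding controls the overshoot.
  have hX : ρ * V / 2 = ∑ i, (V * v i) ^ 2 / (2 * (V * v i / ρ)) := by
    have : ∀ i, (V * v i) ^ 2 / (2 * (V * v i / ρ)) = ρ * V / 2 * v i := fun i => by
      have := (hv i).ne'
      field_simp
    simp_rw [this, ← Finset.mul_sum, hv1, mul_one]
  have hZm : ∀ (x : ℝ) (i : Fin n), Measurable fun y : Fin n → ℝ => Z x (y i) := fun x i =>
    (hanti x).measurable.comp (measurable_pi_apply i)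
  have hinner : ∀ x : Fin n → ℝ, ∫ y, ∑ i, W * v i * Z (x i) (y i) ∂t =
      ∑ i, W * v i * ∫ y, Z (x i) (y i) ∂t := fun x => by
    rw [integral_finsetSum _ fun i _ => (integrable_of_measurable_of_mem_Icc (hZm (x i) i)
      (fun _ => h0 _ _) fun _ => h1 _ _).const_mul _]
    simp_rw [integral_const_mul]
  simp_rw [hinner]
  have hFm : ∀ i, Monotone fun x => ∫ y, Z x (y i) ∂t := fun i =>
    monotone_integral (h := fun x (y : Fin n → ℝ) => Z x (y i)) (fun y => hmono (y i)) (fun x => hZm x i)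
      (fun _ _ => h0 _ _) fun _ _ => h1 _ _
  -- Averaging over the opponent keeps monotonicity in the own allocation, so rescaling is handled
  -- before the integrals are swapped.
  have hmain := le_integral_map_rescale (fun i => uniformType (V * v i) (V * v i / ρ))
    (fun i => (ae_mem_Icc_uniformType (hb i)).mono fun x hx => hx.1) (X := ρ * V / 2) hκ
    (F := fun i x => ∫ y, Z x (y i) ∂t) hFm (fun i x => integral_nonneg fun y => h0 _ _)
    (fun i x => by
      calc ∫ y, Z x (y i) ∂t ≤ ∫ _, (1 : ℝ) ∂t :=
            integral_mono (integrable_of_measurable_of_mem_Icc (hZm x i) (fun _ => h0 _ _)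
              fun _ => h1 _ _) (integrable_const _) fun _ => h1 _ _
        _ = 1 := by simp)
    (w := fun i => W * v i) fun i => mul_nonneg hW (hv i).le
  refine le_trans ?_ hmain
  have hH := pi_uniformType_real_le_sum hb hbd hX (by positivity) hη
  have hyY : ∀ i, ∀ᵐ y ∂t, y i ∈ Set.Icc 0 Y := fun i => htm.mono fun y hy =>
    ⟨hy.1 i, (Finset.single_le_sum (fun j _ => hy.1 j) (Finset.mem_univ i)).trans hy.2⟩
  have hyi : ∀ i, Integrable (fun y : Fin n → ℝ => y i) t := fun i =>
    Integrable.of_mem_Icc 0 Y (measurable_pi_apply i).aemeasurable (hyY i)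
  have hmY : ∑ i, ∫ y, y i ∂t ≤ Y := by
    rw [← integral_finsetSum _ fun i _ => hyi i]
    calc ∫ y, ∑ i, y i ∂t ≤ ∫ _, Y ∂t := integral_mono_ae (integrable_finsetSum _ fun i _ => hyi i)
          (integrable_const _) (htm.mono fun y hy => hy.2)
      _ = Y := by simp
  -- After the swap the bound for fixed $y$ is affine in $y_i$, so only the mean of $y_i$ under `t`
  -- survives.
  have hsingle : ∀ i, ρ * (1 - (1 + η) * (∫ y, y i ∂t) / (V * v i)) - ε - (1 + η) * δ ≤
      ∫ z, ∫ y, Z (z / (1 + η)) (y i) ∂t ∂uniformType (V * v i) (V * v i / ρ) := by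
    intro i
    obtain ⟨hsm, hsw⟩ := integral_uniformType_swap_of_monotone (t := t)
      (h := fun z (y : Fin n → ℝ) => Z (z / (1 + η)) (y i))
      (fun y z z' hz => hmono _ (by gcongr)) (fun x => hZm _ i) (fun _ _ => h0 _ _)
      (fun _ _ => h1 _ _) (hb i) (hbd i)
    rw [hsw]
    have hlin : Integrable (fun y : Fin n → ℝ => ρ * (1 - (1 + η) / (V * v i) * y i)) t :=
      ((integrable_const 1).sub ((hyi i).const_mul _)).const_mul ρ
    have hbd1 : ∀ y : Fin n → ℝ, ∫ z, Z (z / (1 + η)) (y i)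
        ∂uniformType (V * v i) (V * v i / ρ) ≤ 1 := fun y => by
      calc _ ≤ ∫ _, (1 : ℝ) ∂uniformType (V * v i) (V * v i / ρ) :=
            integral_mono (integrable_of_measurable_of_mem_Icc ((hmono (y i)).measurable.comp
              (measurable_id'.div_const (1 + η))) (fun _ => h0 _ _) fun _ => h1 _ _)
              (integrable_const _) fun _ => h1 _ _
        _ = 1 := by simp
    have hle := integral_mono_ae (hlin.sub (integrable_const (ε + (1 + η) * δ))) (integrable_of_measurable_of_mem_Icc hsm
      (fun y => integral_nonneg fun _ => h0 _ _) hbd1) (by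
        filter_upwards [hyY i] with y hy
        have hviV : V * v i ≤ V := by
          refine mul_le_of_le_one_right hV.le ?_
          rw [← hv1]
          exact Finset.single_le_sum (fun j _ => (hv j).le) (Finset.mem_univ i)
        have := le_integral_comp_div_uniformType (hb i) (hbd i) hκ1 hy.1 hviV hε (hmono (y i))
          (fun _ => h0 _ _) (fun _ => h1 _ _) (hbad i (y i) ⟨hy.1, hy.2.trans hY⟩)
        refine le_trans (le_of_eq ?_) this
        have := (hv i).ne'
        simp only [Pi.sub_apply]
        field_simp
        ring)
    refine le_trans (le_of_eq ?_) hle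
    simp only [Pi.sub_apply]
    rw [integral_sub hlin (integrable_const _),
      integral_const_mul, integral_sub (integrable_const _) ((hyi i).const_mul _),
      integral_const_mul]
    simp only [integral_const, probReal_univ, one_smul]
    ring
  -- The weight $v_i$ cancels the $1/v_i$ of the slope: it does not matter how the opponent splits
  -- the budget.
  have hsum : W * (ρ * (1 - (1 + η) * Y / V) - ε - (1 + η) * δ) ≤ ∑ i, W * v i *
      ∫ z, ∫ y, Z (z / (1 + η)) (y i) ∂t ∂uniformType (V * v i) (V * v i / ρ) := by
    calc W * (ρ * (1 - (1 + η) * Y / V) - ε - (1 + η) * δ)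
        ≤ W * (ρ * (1 - (1 + η) * (∑ i, ∫ y, y i ∂t) / V) - ε - (1 + η) * δ) := by gcongr
      _ = ∑ i, W * v i *
          (ρ * (1 - (1 + η) * (∫ y, y i ∂t) / (V * v i)) - ε - (1 + η) * δ) := by
          have : ∀ i, W * v i * (ρ * (1 - (1 + η) * (∫ y, y i ∂t) / (V * v i)) - ε -
              (1 + η) * δ) = W * (ρ - ε - (1 + η) * δ) * v i -
                W * ρ * (1 + η) / V * ∫ y, y i ∂t := fun i => by
            have := (hv i).ne'
            field_simp
            ring
          simp_rw [this]
          rw [Finset.sum_sub_distrib, ← Finset.mul_sum, ← Finset.mul_sum, hv1]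
          ring
      _ ≤ _ := Finset.sum_le_sum fun i _ =>
          mul_le_mul_of_nonneg_left (hsingle i) (mul_nonneg hW (hv i).le)
  have hWv : ∑ i, W * v i = W := by rw [← Finset.mul_sum, hv1, mul_one]
  rw [hWv]
  have := mul_le_mul_of_nonneg_left hH hW
  linarith

/-! ### Contest functions extended to the plane -/

section Clamp

/-- The extension of a function on the closed quadrant to the plane that depends only on the
non-negative parts of the coordinates. -/
def clamp (ζ : ℝ → ℝ → ℝ) (x y : ℝ) : ℝ := ζ (max x 0) (max y 0)

theorem clamp_of_nonneg (ζ : ℝ → ℝ → ℝ) {x y : ℝ} (hx : 0 ≤ x) (hy : 0 ≤ y) :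
    clamp ζ x y = ζ x y := by
  simp [clamp, hx, hy]

namespace IsCSF

variable {ζA ζB : ℝ → ℝ → ℝ} (h : IsCSF ζA ζB)
include h

theorem clamp_nonneg (x y : ℝ) : 0 ≤ clamp ζA x y :=
  h.nonneg_left _ _ (le_max_right _ _) (le_max_right _ _)

theorem clamp_le_one (x y : ℝ) : clamp ζA x y ≤ 1 := by
  rw [← h.add_eq_one (max x 0) (max y 0) (le_max_right _ _) (le_max_right _ _)]
  exact le_add_of_nonneg_right (h.nonneg_right _ _ (le_max_right _ _) (le_max_right _ _))

theorem clamp_right_eq (x y : ℝ) : clamp ζB x y = 1 - clamp ζA x y := by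
  have := h.add_eq_one (max x 0) (max y 0) (le_max_right _ _) (le_max_right _ _)
  simp only [clamp]
  linarith

theorem monotone_clamp (y : ℝ) : Monotone fun x => clamp ζA x y := fun _ _ hx =>
  h.left_mono _ _ _ (le_max_right _ _) (max_le_max_right 0 hx) (le_max_right _ _)

theorem antitone_clamp (x : ℝ) : Antitone (clamp ζA x) := fun _ _ hy =>
  h.left_anti _ _ _ (le_max_right _ _) (le_max_right _ _) (max_le_max_right 0 hy)

end IsCSF

end Clamp

/-- Exchanging the players lets the guarantee for A be reused for B. -/
theorem IsCSF.symm {ζA ζB : ℝ → ℝ → ℝ} (h : IsCSF ζA ζB) :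
    IsCSF (fun x y => ζB y x) (fun x y => ζA y x) where
  nonneg_left x y hx hy := h.nonneg_right y x hy hx
  nonneg_right x y hx hy := h.nonneg_left y x hy hx
  add_eq_one x y hx hy := by rw [add_comm]; exact h.add_eq_one y x hy hx
  left_mono x x' y hx hxx hy := h.right_mono y x x' hy hx hxx
  left_anti x y y' hx hy hyy := h.right_anti y y' x hy hyy hx
  right_mono x y y' hx hy hyy := h.left_mono y y' x hy hyy hx
  right_anti x x' y hx hxx hy := h.left_anti y x x' hy hx hxx

namespace GLBGame

variable {n : ℕ} {XA XB : ℝ} (G : GLBGame n XA XB)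

/-! ### Payoffs and worst cases -/

section Payoff

variable {G} {s t : Measure (Fin n → ℝ)}

/-- Allocations are almost surely nonnegative, and the clamped function is monotone on the whole
plane, which gives measurable sections. -/
theorem payoffA_eq_clamp (hs : s ∈ mixedStrategies n XA) (ht : t ∈ mixedStrategies n XB) :
    G.payoffA s t = ∫ x, ∫ y, ∑ i, G.wA i * clamp G.ζA (x i) (y i) ∂t ∂s := by
  refine integral_congr_ae (hs.2.mono fun x hx => integral_congr_ae (ht.2.mono fun y hy => ?_))
  exact Finset.sum_congr rfl fun i _ => by rw [clamp_of_nonneg _ (hx.1 i) (hy.1 i)]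

theorem payoffB_eq_clamp (hs : s ∈ mixedStrategies n XA) (ht : t ∈ mixedStrategies n XB) :
    G.payoffB s t = ∫ x, ∫ y, ∑ i, G.wB i * clamp G.ζB (x i) (y i) ∂t ∂s := by
  refine integral_congr_ae (hs.2.mono fun x hx => integral_congr_ae (ht.2.mono fun y hy => ?_))
  exact Finset.sum_congr rfl fun i _ => by rw [clamp_of_nonneg _ (hx.1 i) (hy.1 i)]

theorem integrable_clamp [IsProbabilityMeasure t] (x : Fin n → ℝ) (i : Fin n) :
    Integrable (fun y : Fin n → ℝ => clamp G.ζA (x i) (y i)) t :=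
  integrable_of_measurable_of_mem_Icc
    ((G.csf.antitone_clamp (x i)).measurable.comp (measurable_pi_apply i))
    (fun _ => G.csf.clamp_nonneg _ _) fun _ => G.csf.clamp_le_one _ _

theorem integrable_integral_clamp [IsProbabilityMeasure s] [IsProbabilityMeasure t] :
    Integrable (fun x : Fin n → ℝ => ∫ y, ∑ i, G.wA i * clamp G.ζA (x i) (y i) ∂t) s := by
  have hinner : ∀ x : Fin n → ℝ, ∫ y, ∑ i, G.wA i * clamp G.ζA (x i) (y i) ∂t =
      ∑ i, G.wA i * ∫ y, clamp G.ζA (x i) (y i) ∂t := fun x => by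
    rw [integral_finsetSum _ fun i _ => (integrable_clamp x i).const_mul _]
    simp_rw [integral_const_mul]
  simp_rw [hinner]
  refine integrable_finsetSum _ fun i _ => Integrable.const_mul ?_ _
  have hm : Monotone fun x => ∫ y, clamp G.ζA x (y i) ∂t :=
    monotone_integral (h := fun x (y : Fin n → ℝ) => clamp G.ζA x (y i))
      (fun y => G.csf.monotone_clamp (y i))
      (fun x => (G.csf.antitone_clamp x).measurable.comp (measurable_pi_apply i))
      (fun _ _ => G.csf.clamp_nonneg _ _) fun _ _ => G.csf.clamp_le_one _ _
  refine integrable_of_measurable_of_mem_Icc (hm.measurable.comp (measurable_pi_apply i))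
    (fun x => integral_nonneg fun y => G.csf.clamp_nonneg _ _) fun x => ?_
  calc ∫ y, clamp G.ζA (x i) (y i) ∂t ≤ ∫ _, (1 : ℝ) ∂t :=
        integral_mono (integrable_clamp x i) (integrable_const _) fun _ => G.csf.clamp_le_one _ _
    _ = 1 := by simp

theorem integral_clampB_eq (hG : G.IsConstantSum) [IsProbabilityMeasure t] (x : Fin n → ℝ) :
    ∫ y, ∑ i, G.wB i * clamp G.ζB (x i) (y i) ∂t =
      G.WA - ∫ y, ∑ i, G.wA i * clamp G.ζA (x i) (y i) ∂t := by
  have h : ∀ y : Fin n → ℝ, ∑ i, G.wB i * clamp G.ζB (x i) (y i) =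
      G.WA - ∑ i, G.wA i * clamp G.ζA (x i) (y i) := fun y => by
    simp_rw [← hG _, G.csf.clamp_right_eq, mul_sub, mul_one, Finset.sum_sub_distrib]
    rfl
  simp_rw [h]
  rw [integral_sub (integrable_const _)
    (integrable_finsetSum _ fun i _ => (integrable_clamp x i).const_mul _)]
  simp

theorem integrable_integral_clampB (hG : G.IsConstantSum) [IsProbabilityMeasure s]
    [IsProbabilityMeasure t] :
    Integrable (fun x : Fin n → ℝ => ∫ y, ∑ i, G.wB i * clamp G.ζB (x i) (y i) ∂t) s := by
  simp_rw [integral_clampB_eq hG]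
  exact (integrable_const _).sub integrable_integral_clamp

theorem payoffB_eq_sub (hG : G.IsConstantSum) (hs : s ∈ mixedStrategies n XA)
    (ht : t ∈ mixedStrategies n XB) : G.payoffB s t = G.WA - G.payoffA s t := by
  have := hs.1
  have := ht.1
  rw [payoffA_eq_clamp hs ht, payoffB_eq_clamp hs ht]
  simp_rw [integral_clampB_eq hG]
  rw [integral_sub (integrable_const _) integrable_integral_clamp]
  simp

theorem payoffA_nonneg (hs : s ∈ mixedStrategies n XA) (ht : t ∈ mixedStrategies n XB) :
    0 ≤ G.payoffA s t := by
  rw [payoffA_eq_clamp hs ht]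
  exact integral_nonneg fun x => integral_nonneg fun y => Finset.sum_nonneg fun i _ =>
    mul_nonneg (G.wA_pos i).le (G.csf.clamp_nonneg _ _)

theorem payoffB_nonneg (hs : s ∈ mixedStrategies n XA) (ht : t ∈ mixedStrategies n XB) :
    0 ≤ G.payoffB s t := by
  rw [payoffB_eq_clamp hs ht]
  exact integral_nonneg fun x => integral_nonneg fun y => Finset.sum_nonneg fun i _ =>
    mul_nonneg (G.wB_pos i).le (G.csf.symm.clamp_nonneg (y i) (x i))

theorem worstPayoffA_le (hs : s ∈ mixedStrategies n XA) (ht : t ∈ mixedStrategies n XB) :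
    G.worstPayoffA s ≤ G.payoffA s t :=
  -- A real `sInf` is a lower bound only for sets bounded below; here $0$ bounds the payoffs.
  csInf_le ⟨0, by rintro _ ⟨t', ht', rfl⟩; exact payoffA_nonneg hs ht'⟩ ⟨t, ht, rfl⟩

theorem worstPayoffB_le (hs : s ∈ mixedStrategies n XA) (ht : t ∈ mixedStrategies n XB) :
    G.worstPayoffB t ≤ G.payoffB s t :=
  csInf_le ⟨0, by rintro _ ⟨s', hs', rfl⟩; exact payoffB_nonneg hs' ht⟩ ⟨s, hs, rfl⟩

end Payoff

/-! ### The constant-sum game -/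

section ConstantSum

variable {G}

theorem WA_pos (hn : 0 < n) : 0 < G.WA := by
  have : Nonempty (Fin n) := ⟨⟨0, hn⟩⟩
  exact Finset.sum_pos (fun i _ => G.wA_pos i) Finset.univ_nonempty

theorem vA_pos (hn : 0 < n) (i : Fin n) : 0 < G.vA i := div_pos (G.wA_pos i) (WA_pos hn)

theorem sum_vA (hn : 0 < n) : ∑ i, G.vA i = 1 := by
  simp only [vA]
  rw [← Finset.sum_div]
  exact div_self (WA_pos hn).ne'

theorem WA_mul_vA (hn : 0 < n) (i : Fin n) : G.WA * G.vA i = G.wA i :=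
  mul_div_cancel₀ _ (WA_pos hn).ne'

theorem IsConstantSum.WB_eq (hG : G.IsConstantSum) : G.WB = G.WA :=
  Finset.sum_congr rfl fun i _ => (hG i).symm

theorem IsConstantSum.W_eq (hG : G.IsConstantSum) : G.W = G.WA := by
  rw [W, hG.WB_eq, max_self]

theorem IsConstantSum.vB_eq (hG : G.IsConstantSum) (i : Fin n) : G.vB i = G.vA i := by
  rw [vB, vA, hG.WB_eq, hG i]

theorem IsConstantSum.Omega_eq (hG : G.IsConstantSum) (hn : 0 < n) (γ : ℝ) :
    G.Omega γ = if γ < 1 then Finset.univ else ∅ := by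
  have h : ∀ i, G.vA i / G.vB i = 1 := fun i => by rw [hG.vB_eq, div_self (vA_pos hn i).ne']
  ext i
  by_cases hγ : γ < 1 <;> simp [Omega, h, hγ]

theorem IsConstantSum.sum_sq_div (hG : G.IsConstantSum) (hn : 0 < n) :
    ∑ i, G.vA i ^ 2 / G.vB i = 1 := by
  rw [← sum_vA hn]
  refine Finset.sum_congr rfl fun i _ => ?_
  rw [hG.vB_eq, sq, mul_div_cancel_right₀ _ (vA_pos hn i).ne']

theorem IsConstantSum.gammaSolutions_eq (hG : G.IsConstantSum) (hn : 0 < n) (hXA : 0 < XA)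
    (hXAB : XA ≤ XB) : G.gammaSolutions = {XB / XA} := by
  have hXB : 0 < XB := hXA.trans_le hXAB
  have hS := hG.sum_sq_div hn
  have hS' : ∑ i, G.vB i ^ 2 / G.vA i = 1 := by
    rw [← hS]
    exact Finset.sum_congr rfl fun i _ => by rw [hG.vB_eq]
  have hB : ∑ i, G.vB i = 1 := by simp_rw [hG.vB_eq]; exact sum_vA hn
  ext γ
  simp only [gammaSolutions, Set.mem_ofPred_eq, Set.mem_singleton_iff, hG.Omega_eq hn]
  have h1 : 1 ≤ XB / XA := (one_le_div hXA).2 hXAB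
  constructor
  · rintro ⟨hγ, h⟩
    -- Both cases reduce to $\gamma X_B/X_A=\gamma^2$; the case $\gamma<1$ then contradicts
    -- $X_B/X_A\ge1$.
    split_ifs at h with hγ1
    · simp [hS', hB] at h
      have : γ * (XB / XA) = γ * γ := by rw [← sq, ← h]; ring
      have := mul_left_cancel₀ hγ.ne' this
      linarith
    · simp [hS, sum_vA hn] at h
      have : γ * (XB / XA) = γ * γ := by rw [← sq, ← h]; ring
      exact (mul_left_cancel₀ hγ.ne' this).symm
  · rintro rfl
    refine ⟨by positivity, ?_⟩
    rw [if_neg (not_lt.2 h1)]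
    simp [hS, sum_vA hn]
    field_simp

variable (hG : G.IsConstantSum) (hn : 0 < n) (hXA : 0 < XA) (hXAB : XA ≤ XB)
include hG hn hXA hXAB

theorem IsConstantSum.Omega_eq_empty : G.Omega (XB / XA) = ∅ := by
  rw [hG.Omega_eq hn, if_neg (not_lt.2 ((one_le_div hXA).2 hXAB))]

theorem IsConstantSum.vA_div_lamA (i : Fin n) :
    G.vA i / G.lamA (XB / XA) = 2 * XB * G.vA i := by
  have hXB : 0 < XB := hXA.trans_le hXAB
  simp [lamA, hG.Omega_eq_empty hn hXA hXAB, sum_vA hn]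
  field_simp

theorem IsConstantSum.vB_div_lamB (i : Fin n) :
    G.vB i / G.lamB (XB / XA) = 2 * XB * G.vA i / (XA / XB) := by
  have hXB : 0 < XB := hXA.trans_le hXAB
  simp [lamB, hG.Omega_eq_empty hn hXA hXAB, hG.sum_sq_div hn]
  rw [hG.vB_eq]
  field_simp

theorem IsConstantSum.starA_eq : G.starA (XB / XA) = fun i =>
    uniformType (2 * XB * G.vA i) (2 * XB * G.vA i / (XA / XB)) := by
  ext1 i
  rw [starA, hG.Omega_eq_empty hn hXA hXAB, if_neg (Finset.notMem_empty i),
    hG.vA_div_lamA hn hXA hXAB, hG.vB_div_lamB hn hXA hXAB]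

/-- The division by $1$ displays the case $\rho=1$ of the family used for both players. -/
theorem IsConstantSum.starB_eq : G.starB (XB / XA) = fun i =>
    uniformType (2 * XB * G.vA i) (2 * XB * G.vA i / 1) := by
  ext1 i
  rw [starB, hG.Omega_eq_empty hn hXA hXAB, if_neg (Finset.notMem_empty i),
    hG.vA_div_lamA hn hXA hXAB, div_one]

theorem IsConstantSum.IUA_mem : G.IUA (XB / XA) ∈ mixedStrategies n XA := by
  have hXB : 0 < XB := hXA.trans_le hXAB
  have hb : ∀ i, 0 < 2 * XB * G.vA i := fun i => mul_pos (by positivity) (vA_pos hn i)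
  have hp : ∀ i, IsProbabilityMeasure
      (uniformType (2 * XB * G.vA i) (2 * XB * G.vA i / (XA / XB))) := fun i =>
    isProbabilityMeasure_uniformType (hb i) (by
      rw [le_div_iff₀ (by positivity)]
      exact mul_le_of_le_one_right (hb i).le ((div_le_one hXB).2 hXAB))
  rw [IUA, hG.starA_eq hn hXA hXAB]
  exact map_rescale_mem_mixedStrategies _
    (fun i => (ae_mem_Icc_uniformType (hb i)).mono fun x hx => hx.1) hXA.le

theorem IsConstantSum.IUB_mem : G.IUB (XB / XA) ∈ mixedStrategies n XB := by
  have hXB : 0 < XB := hXA.trans_le hXAB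
  have hb : ∀ i, 0 < 2 * XB * G.vA i := fun i => mul_pos (by positivity) (vA_pos hn i)
  have hp : ∀ i, IsProbabilityMeasure
      (uniformType (2 * XB * G.vA i) (2 * XB * G.vA i / 1)) := fun i =>
    isProbabilityMeasure_uniformType (hb i) (by rw [div_one])
  rw [IUB, hG.starB_eq hn hXA hXAB]
  exact map_rescale_mem_mixedStrategies _
    (fun i => (ae_mem_Icc_uniformType (hb i)).mono fun x hx => hx.1) hXB.le

/-- The payoff that the independently uniform strategy guarantees to Player A. -/
theorem IsConstantSum.le_payoffA_IUA {ε δ : ℝ} (hε : 0 ≤ ε) (hδ : δ ∈ G.Delta (XB / XA) ε)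
    {t : Measure (Fin n → ℝ)} (ht : t ∈ mixedStrategies n XB) :
    G.WA * (XA / XB * (1 - (1 + ε) / 2) - ε - (1 + ε) * δ -
      Real.exp (-(ε * XA) ^ 2 / (2 * ∑ i, (XB * G.vA i) ^ 2))) ≤
      G.payoffA (G.IUA (XB / XA)) t := by
  have hXB : 0 < XB := hXA.trans_le hXAB
  rw [payoffA_eq_clamp (hG.IUA_mem hn hXA hXAB) ht]
  have hbad : ∀ i, ∀ y ∈ Set.Icc 0 (2 * XB),
      (uniformType (2 * XB * G.vA i) (2 * XB * G.vA i / (XA / XB))).real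
        {x | x ∈ Set.Icc 0 (2 * XB) ∧ y < x ∧ clamp G.ζA x y ≤ 1 - ε} ≤ δ := by
    intro i y hy
    have h := hδ.2.1 i y hy
    simp only [hG.starA_eq hn hXA hXAB] at h
    refine (measureReal_mono ?_).trans h
    rintro x ⟨hx, hxy, hle⟩
    refine ⟨hx, ?_⟩
    rw [clamp_of_nonneg _ hx.1 hy.1] at hle
    -- For $y<x$ the Blotto function is $1$, so the tie-breaking parameter plays no role.
    rw [blottoA, if_pos hxy, abs_sub_comm]
    exact le_trans (by linarith) (le_abs_self _)
  have h := le_integral_integral_map_rescale (V := 2 * XB) (ρ := XA / XB) (W := G.WA) (η := ε)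
    (ε := ε) (δ := δ) (by positivity) (by positivity) ((div_le_one hXB).2 hXAB) (WA_pos hn).le
    hε hε (vA_pos hn) (sum_vA hn) G.csf.monotone_clamp G.csf.antitone_clamp G.csf.clamp_nonneg
    G.csf.clamp_le_one hbad ht (by linarith)
  have e1 : XA / XB * (2 * XB) / 2 = XA := by field_simp
  have e2 : (1 + ε) * XB / (2 * XB) = (1 + ε) / 2 := by field_simp
  have e3 : ∀ i, 2 * XB * G.vA i / 2 = XB * G.vA i := fun i => by ring
  simp_rw [e1, e2, e3, WA_mul_vA hn] at h
  rw [IUA, hG.starA_eq hn hXA hXAB]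
  exact h

/-- The payoff that the independently uniform strategy guarantees to Player B. -/
theorem IsConstantSum.le_payoffB_IUB {ε δ : ℝ} (hε : 0 ≤ ε) (hδ : δ ∈ G.Delta (XB / XA) ε)
    {s : Measure (Fin n → ℝ)} (hs : s ∈ mixedStrategies n XA) :
    G.WA * (1 - (1 + ε) * XA / (2 * XB) - ε - (1 + ε) * δ -
      Real.exp (-(ε * XB) ^ 2 / (2 * ∑ i, (XB * G.vA i) ^ 2))) ≤
      G.payoffB s (G.IUB (XB / XA)) := by
  have hXB : 0 < XB := hXA.trans_le hXAB
  have hI := hG.IUB_mem hn hXA hXAB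
  have := hI.1
  have := hs.1
  rw [payoffB_eq_clamp hs hI]
  have hbad : ∀ i, ∀ x ∈ Set.Icc 0 (2 * XB),
      (uniformType (2 * XB * G.vA i) (2 * XB * G.vA i / 1)).real
        {y | y ∈ Set.Icc 0 (2 * XB) ∧ x < y ∧ clamp (fun y x => G.ζB x y) y x ≤ 1 - ε} ≤ δ := by
    intro i x hx
    have h := hδ.2.2 i x hx
    simp only [hG.starB_eq hn hXA hXAB] at h
    refine (measureReal_mono ?_).trans h
    rintro y ⟨hy, hxy, hle⟩
    refine ⟨hy, ?_⟩
    rw [clamp_of_nonneg _ hy.1 hx.1] at hle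
    rw [blottoB, if_pos hxy, abs_sub_comm]
    exact le_trans (by linarith) (le_abs_self _)
  -- In B's payoff the outer integral is over A's allocation. Bounding the inner one for each pure
  -- $x$, via a Dirac mass, avoids exchanging the two players' integrals.
  have hpure : ∀ x ∈ pureStrategies n XA, G.WA * (1 - (1 + ε) * XA / (2 * XB) - ε - (1 + ε) * δ -
      Real.exp (-(ε * XB) ^ 2 / (2 * ∑ i, (XB * G.vA i) ^ 2))) ≤
      ∫ y, ∑ i, G.wB i * clamp G.ζB (x i) (y i) ∂G.IUB (XB / XA) := by
    intro x hx
    have hd : Measure.dirac x ∈ mixedStrategies n XA :=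
      ⟨inferInstance, (ae_dirac_iff (p := (· ∈ pureStrategies n XA))
        (measurableSet_pureStrategies XA)).2 hx⟩
    have h := le_integral_integral_map_rescale (V := 2 * XB) (ρ := 1) (W := G.WA) (η := ε)
      (ε := ε) (δ := δ) (by positivity) one_pos le_rfl (WA_pos hn).le
      hε hε (vA_pos hn) (sum_vA hn) G.csf.symm.monotone_clamp G.csf.symm.antitone_clamp
      G.csf.symm.clamp_nonneg G.csf.symm.clamp_le_one hbad hd (by linarith)
    have e1 : 1 * (2 * XB) / 2 = XB := by ring
    have e3 : ∀ i, 2 * XB * G.vA i / 2 = XB * G.vA i := fun i => by ring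
    simp_rw [e1, e3, WA_mul_vA hn, integral_dirac, one_mul] at h
    rw [IUB, hG.starB_eq hn hXA hXAB]
    simp_rw [← hG _]
    exact h
  calc _ = ∫ _, G.WA * (1 - (1 + ε) * XA / (2 * XB) - ε - (1 + ε) * δ -
        Real.exp (-(ε * XB) ^ 2 / (2 * ∑ i, (XB * G.vA i) ^ 2))) ∂s := by simp
    _ ≤ _ := integral_mono_ae (integrable_const _) (integrable_integral_clampB hG)
        (hs.2.mono hpure)

end ConstantSum

/-- Each $v_i$ is at most $\bar w/(\underline w n)$, so Hoeffding's variance proxy is $O(1/n)$. -/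
theorem ValuesBounded.sum_sq_le {G : GLBGame n XA XB} {wlo whi : ℝ} (hG : G.ValuesBounded wlo whi)
    (hn : 0 < n) (hwlo : 0 < wlo) (c : ℝ) :
    ∑ i, (c * G.vA i) ^ 2 ≤ (c * (whi / wlo)) ^ 2 / n := by
  have hn' : (0 : ℝ) < n := by exact_mod_cast hn
  have hW : n * wlo ≤ G.WA := by
    have := Finset.card_nsmul_le_sum Finset.univ G.wA wlo fun i _ => (hG i).1.1
    rw [Finset.card_univ, Fintype.card_fin, nsmul_eq_mul] at this
    exact this
  have hv : ∀ i, G.vA i ≤ whi / wlo / n := fun i => by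
    rw [div_div, mul_comm wlo]
    have := (G.wA_pos i).le.trans (hG i).1.2
    exact div_le_div₀ this (hG i).1.2 (by positivity) hW
  calc ∑ i, (c * G.vA i) ^ 2 ≤ ∑ _i : Fin n, c ^ 2 * (whi / wlo / n) ^ 2 := by
        refine Finset.sum_le_sum fun i _ => ?_
        rw [mul_pow]
        have := (vA_pos (G := G) hn i).le
        gcongr
        exact hv i
    _ = _ := by
        simp
        field_simp

end GLBGame

/-! ### The error sequence -/

section ErrorSequence

/-- The error sequence `2 M (1 + log (n + 1)) / √(n + 1)`. -/
def errorSeq (M : ℝ) (n : ℕ) : ℝ := 2 * M * (1 + Real.log (n + 1)) / √(n + 1)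

theorem errorSeq_pos {M : ℝ} (hM : 0 < M) (n : ℕ) : 0 < errorSeq M n := by
  have : 0 ≤ Real.log ((n : ℝ) + 1) := Real.log_nonneg (by linarith [n.cast_nonneg (α := ℝ)])
  unfold errorSeq
  positivity

theorem isSoftO_errorSeq {M : ℝ} (hM : 0 < M) :
    IsSoftO (errorSeq M) fun n : ℕ => (n : ℝ) ^ (-(1 / 2) : ℝ) := by
  refine ⟨1, IsBigO.of_bound (6 * M) ?_⟩
  filter_upwards [eventually_ge_atTop 3] with n hn
  have hn' : (3 : ℝ) ≤ n := by exact_mod_cast hn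
  have hlog1 : 1 ≤ Real.log n := by
    rw [Real.le_log_iff_exp_le (by linarith)]
    linarith [Real.exp_one_lt_d9]
  have hlog2 : Real.log (n + 1) ≤ 2 * Real.log n := by
    rw [← Real.log_rpow (by linarith)]
    refine Real.log_le_log (by linarith) ?_
    rw [Real.rpow_two]
    nlinarith
  have hsq : (n : ℝ) ^ (-(1 / 2) : ℝ) = 1 / √n := by
    rw [Real.rpow_neg (by linarith), ← Real.sqrt_eq_rpow, one_div]
  rw [Real.norm_of_nonneg (errorSeq_pos hM n).le, hsq, pow_one,
    Real.norm_of_nonneg (by positivity), errorSeq]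
  calc 2 * M * (1 + Real.log (n + 1)) / √(n + 1) ≤ 2 * M * (3 * Real.log n) / √n := by
        gcongr
        · linarith
        · linarith
    _ = _ := by ring

/-- With overshoot $\eta=\varepsilon_n$ of order $\ln n/\sqrt n$ and $S=O(1/n)$, the exponent is at
least $\ln(n+1)$, so the Hoeffding tail is at most $1/(n+1)\le\varepsilon_n$. -/
theorem exp_neg_sq_div_le_errorSeq {X P K S : ℝ} {n : ℕ} (hn : 0 < n) (hX : 0 < X) (hXK : X ≤ K)
    (hXP : X ≤ P) (hS0 : 0 < S) (hS : S ≤ K ^ 2 / n) :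
    Real.exp (-(errorSeq (K / X) n * P) ^ 2 / (2 * S)) ≤ errorSeq (K / X) n := by
  have hn1 : (1 : ℝ) ≤ n := by exact_mod_cast hn
  have hK : 0 < K := hX.trans_le hXK
  set l := Real.log ((n : ℝ) + 1) with hl
  have hl0 : 0 ≤ l := Real.log_nonneg (by linarith)
  have hpos := errorSeq_pos (div_pos hK hX) n
  have h1 : l ≤ (errorSeq (K / X) n * P) ^ 2 / (2 * S) := by
    calc l ≤ (1 + l) ^ 2 := by nlinarith
      -- The factor $2$ in `errorSeq` pays for the denominator $2S$ and for $n+1$ in place of $n$.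
      _ ≤ (1 + l) ^ 2 * (2 * n / (n + 1)) := by
          refine le_mul_of_one_le_right (by positivity) ?_
          rw [one_le_div (by positivity)]
          linarith
      _ = (errorSeq (K / X) n * X) ^ 2 / (2 * (K ^ 2 / n)) := by
          have hsq : √((n : ℝ) + 1) ^ 2 = n + 1 := Real.sq_sqrt (by positivity)
          rw [errorSeq, ← hl, mul_pow, div_pow, hsq]
          field_simp
      _ ≤ (errorSeq (K / X) n * P) ^ 2 / (2 * S) := by gcongr
  calc Real.exp (-(errorSeq (K / X) n * P) ^ 2 / (2 * S)) ≤ Real.exp (-l) := by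
        rw [neg_div]
        exact Real.exp_le_exp.2 (neg_le_neg h1)
    _ = 1 / ((n : ℝ) + 1) := by rw [Real.exp_neg, hl, Real.exp_log (by positivity), one_div]
    _ ≤ 1 / √((n : ℝ) + 1) := by
        refine one_div_le_one_div_of_le (by positivity) ?_
        rw [Real.sqrt_le_left (by positivity)]
        nlinarith
    _ ≤ errorSeq (K / X) n := by
        rw [errorSeq, ← hl]
        gcongr
        have : 1 ≤ K / X := (one_le_div hX).2 hXK
        nlinarith

end ErrorSequence
end

/-! ### Approximate optimality -/

theorem mainTheorem7 (XA XB wlo whi : ℝ) (hXA : 0 < XA) (hXAB : XA ≤ XB) (hwlo : 0 < wlo)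
    (hwhi : wlo ≤ whi) :
    ∃ ε : ℕ → ℝ, (∀ n, 0 < ε n) ∧ IsSoftO ε (fun n : ℕ => (n : ℝ) ^ (-(1 / 2) : ℝ)) ∧
      ∀ n : ℕ, 3 ≤ n → ∀ G : GLBGame n XA XB, G.IsConstantSum → G.ValuesBounded wlo whi →
        G.gammaSolutions = {XB / XA} ∧
        ∀ γ ∈ G.gammaSolutions,
          G.IUA γ ∈ mixedStrategies n XA ∧
          G.IUB γ ∈ mixedStrategies n XB ∧
          ∀ δ ∈ G.Delta γ (ε n),
            (∀ s ∈ mixedStrategies n XA,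
              G.worstPayoffA s ≤ G.worstPayoffA (G.IUA γ) + (8 * δ + 13 * ε n) * G.W) ∧
            (∀ t ∈ mixedStrategies n XB,
              G.worstPayoffB t ≤ G.worstPayoffB (G.IUB γ) + (8 * δ + 13 * ε n) * G.W) := by
  have hXB : 0 < XB := hXA.trans_le hXAB
  have hratio : 1 ≤ whi / wlo := (one_le_div hwlo).2 hwhi
  have hXK : XA ≤ XB * (whi / wlo) := hXAB.trans (le_mul_of_one_le_right hXB.le hratio)
  have hM : 0 < XB * (whi / wlo) / XA := by positivity
  refine ⟨errorSeq (XB * (whi / wlo) / XA), errorSeq_pos hM, isSoftO_errorSeq hM,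
    fun n hn3 G hG hval => ?_⟩
  have hn : 0 < n := by omega
  have hne : Nonempty (Fin n) := ⟨⟨0, hn⟩⟩
  have hsol := hG.gammaSolutions_eq hn hXA hXAB
  refine ⟨hsol, fun γ hγ => ?_⟩
  rw [hsol, Set.mem_singleton_iff] at hγ
  subst hγ
  have hIA := hG.IUA_mem hn hXA hXAB
  have hIB := hG.IUB_mem hn hXA hXAB
  refine ⟨hIA, hIB, fun δ hδ => ?_⟩
  have hS0 : 0 < ∑ i, (XB * G.vA i) ^ 2 := Finset.sum_pos
    (fun i _ => pow_pos (mul_pos hXB (GLBGame.vA_pos hn i)) 2) Finset.univ_nonempty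
  have hS := hval.sum_sq_le hn hwlo XB
  have hexpA := exp_neg_sq_div_le_errorSeq hn hXA hXK le_rfl hS0 hS
  have hexpB := exp_neg_sq_div_le_errorSeq hn hXA hXK hXAB hS0 hS
  have hε := errorSeq_pos hM n
  set e := errorSeq (XB * (whi / wlo) / XA) n
  have hW := GLBGame.WA_pos (G := G) hn
  obtain ⟨hδ0, hδ1⟩ := hδ.1
  have hρ1 : XA / XB ≤ 1 := (div_le_one hXB).2 hXAB
  have hρe : XA / XB * e ≤ e := mul_le_of_le_one_left hε.le hρ1
  have hδe : e * δ ≤ e := mul_le_of_le_one_right hε.le hδ1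
  -- The $7/2$ collects $1/2$ from the overshoot factor in $\rho(1-(1+e)/2)$ and $1$ each from the
  -- closeness $\varepsilon$, from $e\delta\le e$ and from the Hoeffding tail.
  have hA : ∀ t ∈ mixedStrategies n XB,
      G.WA * (XA / XB / 2 - 7 / 2 * e - δ) ≤ G.payoffA (G.IUA (XB / XA)) t := fun t ht => by
    refine le_trans ?_ (hG.le_payoffA_IUA hn hXA hXAB hε.le hδ ht)
    exact mul_le_mul_of_nonneg_left (by linarith) hW.le
  have hB : ∀ s ∈ mixedStrategies n XA,
      G.WA * (1 - XA / XB / 2 - 7 / 2 * e - δ) ≤ G.payoffB s (G.IUB (XB / XA)) := fun s hs => by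
    refine le_trans ?_ (hG.le_payoffB_IUB hn hXA hXAB hε.le hδ hs)
    have : (1 + e) * XA / (2 * XB) = XA / XB / 2 + XA / XB * e / 2 := by
      field_simp
    rw [this]
    exact mul_le_mul_of_nonneg_left (by linarith) hW.le
  have hslack : G.WA * (7 * e + 2 * δ) ≤ (8 * δ + 13 * e) * G.WA := by
    rw [mul_comm]
    exact mul_le_mul_of_nonneg_right (by linarith) hW.le
  rw [hG.W_eq]
  constructor
  · intro s hs
    -- B's independently uniform strategy is the test opponent: its guarantee caps the worst case of
    -- any `s`.
    have h1 := GLBGame.worstPayoffA_le (G := G) hs hIB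
    have h2 := hB s hs
    rw [GLBGame.payoffB_eq_sub hG hs hIB] at h2
    have h3 : G.WA * (XA / XB / 2 - 7 / 2 * e - δ) ≤ G.worstPayoffA (G.IUA (XB / XA)) :=
      le_csInf ⟨_, _, hIB, rfl⟩ (by rintro _ ⟨t, ht, rfl⟩; exact hA t ht)
    linarith
  · intro t ht
    have h1 := GLBGame.worstPayoffB_le (G := G) hIA ht
    have h2 := hA t ht
    rw [GLBGame.payoffB_eq_sub hG hIA ht] at h1
    have h3 : G.WA * (1 - XA / XB / 2 - 7 / 2 * e - δ) ≤ G.worstPayoffB (G.IUB (XB / XA)) :=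
      le_csInf ⟨_, _, hIA, rfl⟩ (by rintro _ ⟨s, hs, rfl⟩; exact hB s hs)
    linarith
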